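/- Let $s\in(0,1)$, $\alpha,\beta\in(0,2s]$ and $\kappa,C_1,C_2\in(0,+\infty)$. Let $\phi\in C^\infty(\mathbb{R})$ satisfy $\phi'>0$ in $\mathbb{R}$ and $$\phi(x)=\begin{cases}-1+C_1|x|^{-\alpha} & \text{if } x<-\kappa,\\ 1-C_2|x|^{-\beta} & \text{if } x>\kappa,\end{cases}$$ so that $\phi$ is a bijection of $\mathbb{R}$ onto $(-1,1)$. Let $$L_s\phi(x):=\mathrm{PV}\int_{\mathbb{R}}\frac{\phi(y)-\phi(x)}{|x-y|^{1+2s}}\,dy=\lim_{\varepsilon\to0^+}\int_{\{|x-y|\ge\varepsilon\}}\frac{\phi(y)-\phi(x)}{|x-y|^{1+2s}}\,dy ,$$ $$h(r):=(L_s\phi)(\phi^{-1}(r))\quad\text{for } r\in(-1,1),\qquad V(r):=\int_{-1}^r h(\rho)\,d\rho\quad\text{for } r\in[-1,1].$$ Then these objects are well defined (the principal value exists and is finite for every $x\in\mathbb{R}$, and $h$ is integrable on $(-1,1)$), $V\in C^\infty((-1,1))$, and for every $i\in\mathbb{N}=\{0,1,2,\dots\}$ the limits $$\lim_{r\to-1^+}\frac{V^{(i+1)}(r)}{(1+r)^{\frac{2s}{\alpha}-i}}\qquad\text{and}\qquad\lim_{r\to1^-}\frac{V^{(i+1)}(r)}{(1-r)^{\frac{2s}{\beta}-i}}$$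 exist and are finite. -/

import Mathlib

open Set Filter Topology MeasureTheory
open scoped ContDiff

/-- The integrand `y ↦ (u(y) - u(x)) / |x - y|^(1+2s)` of the one-dimensional fractional Laplacian
at the point `x`. -/
noncomputable def fracLapIntegrand (s : ℝ) (u : ℝ → ℝ) (x y : ℝ) : ℝ :=
  (u y - u x) / |x - y| ^ (1 + 2 * s)

/-- The truncated integral over `{y : |x - y| ≥ ε}`, whose limit as `ε → 0⁺` is the
principal value at `x`. -/
noncomputable def fracLapTrunc (s : ℝ) (u : ℝ → ℝ) (x ε : ℝ) : ℝ :=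
  ∫ y in {y : ℝ | ε ≤ |x - y|}, fracLapIntegrand s u x y

/-- The principal value integral defining `L_s u (x)` converges: every truncated integral is
absolutely convergent and the truncated integrals have a finite limit as `ε → 0⁺`. -/
def FracLapConverges (s : ℝ) (u : ℝ → ℝ) (x : ℝ) : Prop :=
  (∀ ε > 0, IntegrableOn (fracLapIntegrand s u x) {y : ℝ | ε ≤ |x - y|}) ∧
    ∃ l : ℝ, Tendsto (fracLapTrunc s u x) (𝓝[>] 0) (𝓝 l)

/-- The one-dimensional fractional Laplacian
`L_s u (x) = PV ∫ (u(y) - u(x)) / |x - y|^(1+2s) dy`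
(without normalizing constant, and with this sign). -/
noncomputable def fracLap (s : ℝ) (u : ℝ → ℝ) (x : ℝ) : ℝ :=
  limUnder (𝓝[>] 0) (fracLapTrunc s u x)

/-- `h(r) = (L_s φ)(φ⁻¹(r))`. For injective `φ`, `Function.invFun φ` is the inverse function
on the range of `φ`; for the layers considered the range is `(-1, 1)`. -/
noncomputable def layerForce (s : ℝ) (φ : ℝ → ℝ) (r : ℝ) : ℝ :=
  fracLap s φ (Function.invFun φ r)

/-- The potential `V(r) = ∫_{-1}^r h(ρ) dρ`; only its values on `[-1, 1]` are meaningful. -/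
noncomputable def layerPotential (s : ℝ) (φ : ℝ → ℝ) (r : ℝ) : ℝ :=
  ∫ ρ in (-1 : ℝ)..r, layerForce s φ ρ

/-! Symmetrising in y - x turns the principal value into the absolutely convergent integral
`symmFracLap`, which commutes with d/dx. Hence L_s φ is smooth and bounded, and h is smooth on (-1,
1) by the inverse function theorem. Near r = 1 the point x = φ⁻¹(r) is exactly (t / C₂)^(-1/β) with
t = 1 - r. The dilation z = x w gives L_s φ(x) = x^(-2s) S φ(x), where S = `scaledFracLap` commutes
with E = x d/dx. Along this curve t d/dt = -β⁻¹ E, so differentiating t^q S u yields t^(q-1) S(q u -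
β⁻¹ E u). Smooth functions with explicit power tails (`PowerTails`) are stable under E and linear
combinations; by induction (`exists_iteratedDeriv_eq`) V^(i+1) is a constant times t^(2s/β - i) S v
with v in this class. Finally S v converges at infinity by dominated convergence
(`tendsto_scaledFracLap`), the domination resting on v'' = O(x⁻²). The end r = -1 follows by
reflection. -/

/-- The centred second difference of `u` at `x` with step `z`. -/
def secondDiff (u : ℝ → ℝ) (x z : ℝ) : ℝ := u (x + z) + u (x - z) - 2 * u x

/-- The symmetrised, absolutely convergent form of the fractional Laplacian. -/
noncomputable def symmFracLap (s : ℝ) (u : ℝ → ℝ) (x : ℝ) : ℝ :=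
  ∫ z in Ioi (0 : ℝ), secondDiff u x z / z ^ (1 + 2 * s)

/-- The symmetrised fractional Laplacian at `x` after the dilation `z = x * w`. -/
noncomputable def scaledFracLap (s : ℝ) (u : ℝ → ℝ) (x : ℝ) : ℝ :=
  ∫ w in Ioi (0 : ℝ), secondDiff u x (x * w) / w ^ (1 + 2 * s)

/-- The Euler operator `u ↦ x u'(x)`. -/
noncomputable def eulerOp (u : ℝ → ℝ) (x : ℝ) : ℝ := x * deriv u x

/-! ### Second differences and integrability of the symmetrised kernel -/

theorem continuous_secondDiff {u : ℝ → ℝ} (hu : Continuous u) (x c : ℝ) :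
    Continuous fun z => secondDiff u x (c * z) := by
  unfold secondDiff; fun_prop

theorem abs_secondDiff_le_of_bound {u : ℝ → ℝ} {A : ℝ} (hA : ∀ x, |u x| ≤ A) (x z : ℝ) :
    |secondDiff u x z| ≤ 4 * A := by
  have h1 := abs_le.1 (hA (x + z))
  have h2 := abs_le.1 (hA (x - z))
  have h3 := abs_le.1 (hA x)
  unfold secondDiff
  rw [abs_le]
  constructor <;> linarith

/-- The mean value inequality is used twice: for u' between x - t and x + t, then in the step t.
Only u'' on the interval of radius z enters, so a decaying u'' gives a decaying bound. -/
theorem abs_secondDiff_le_sq {u : ℝ → ℝ} (hu : ContDiff ℝ ∞ u) {x z B : ℝ} (hz : 0 ≤ z)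
    (hB : ∀ y ∈ Icc (x - z) (x + z), |deriv (deriv u) y| ≤ B) :
    |secondDiff u x z| ≤ 2 * B * z ^ 2 := by
  have hu1 : Differentiable ℝ u := hu.differentiable (by simp)
  have hu' : ContDiff ℝ ∞ (deriv u) := (contDiff_infty_iff_deriv.1 hu).2
  have hu2 : Differentiable ℝ (deriv u) := hu'.differentiable (by simp)
  have hd : ∀ t, HasDerivAt (fun t => secondDiff u x t) (deriv u (x + t) - deriv u (x - t)) t := by
    intro t
    have h1 := (hu1 (x + t)).hasDerivAt.comp_const_add x t
    have h2 := (hu1 (x - t)).hasDerivAt.comp_const_sub x t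
    simpa [secondDiff, sub_eq_add_neg] using (h1.add h2).sub_const (2 * u x)
  have hb : ∀ t ∈ Icc 0 z, ‖deriv u (x + t) - deriv u (x - t)‖ ≤ 2 * B * z := by
    intro t ht
    have := (convex_Icc (x - z) (x + z)).norm_image_sub_le_of_norm_deriv_le
      (f := deriv u) (C := B) (x := x - t) (y := x + t) (fun y _ => hu2 y) hB
      ⟨by linarith [ht.2], by linarith [ht.1]⟩ ⟨by linarith [ht.1], by linarith [ht.2]⟩
    have hB0 : 0 ≤ B := (abs_nonneg _).trans (hB x ⟨by linarith, by linarith⟩)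
    refine this.trans ?_
    rw [Real.norm_eq_abs, show x + t - (x - t) = 2 * t by ring, abs_of_nonneg (by linarith [ht.1])]
    nlinarith [ht.2]
  have := (convex_Icc 0 z).norm_image_sub_le_of_norm_hasDerivWithin_le
    (f := fun t => secondDiff u x t) (x := 0) (y := z)
    (fun t _ => (hd t).hasDerivWithinAt) hb ⟨le_rfl, hz⟩ ⟨hz, le_rfl⟩
  have h0 : secondDiff u x 0 = 0 := by simp [secondDiff]; ring
  simp only [h0, sub_zero, Real.norm_eq_abs, abs_of_nonneg hz] at this
  linarith [this]

theorem abs_secondDiff_le_min {u : ℝ → ℝ} (hu : ContDiff ℝ ∞ u) {A B : ℝ} (hA : ∀ x, |u x| ≤ A)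
    (hB : ∀ x, |deriv (deriv u) x| ≤ B) (x : ℝ) {z : ℝ} (hz : 0 ≤ z) :
    |secondDiff u x z| ≤ (4 * A + 2 * B) * min 1 (z ^ 2) := by
  have h1 := abs_secondDiff_le_of_bound hA x z
  have h2 := abs_secondDiff_le_sq hu (x := x) hz fun y _ => hB y
  have hA0 : 0 ≤ A := (abs_nonneg _).trans (hA 0)
  have hB0 : 0 ≤ B := (abs_nonneg _).trans (hB 0)
  rcases min_choice 1 (z ^ 2) with h | h <;> rw [h]
  · linarith
  · nlinarith [sq_nonneg z]

theorem integrableOn_inv_rpow {s : ℝ} (hs : 0 < s) {a : ℝ} (ha : 0 < a) :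
    IntegrableOn (fun z : ℝ => 1 / z ^ (1 + 2 * s)) (Ioi a) := by
  refine (integrableOn_Ioi_rpow_of_lt (a := -(1 + 2 * s)) (by linarith) ha).congr_fun ?_
    measurableSet_Ioi
  intro z hz
  simp only [Real.rpow_neg (ha.trans hz).le, one_div]

theorem integrableOn_min_kernel {s : ℝ} (hs : s ∈ Ioo (0 : ℝ) 1) :
    IntegrableOn (fun z : ℝ => min 1 (z ^ 2) / z ^ (1 + 2 * s)) (Ioi 0) := by
  rw [← Ioc_union_Ioi_eq_Ioi zero_le_one]
  refine IntegrableOn.union ?_ ?_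
  · have h := (intervalIntegral.intervalIntegrable_rpow' (a := 0) (b := 1) (r := 1 - 2 * s)
      (by linarith [hs.2]))
    rw [intervalIntegrable_iff_integrableOn_Ioc_of_le zero_le_one] at h
    refine h.congr_fun ?_ measurableSet_Ioc
    intro z hz
    have : z ^ 2 ≤ 1 := pow_le_one₀ hz.1.le hz.2
    simp only [min_eq_right this]
    rw [← Real.rpow_natCast, ← Real.rpow_sub hz.1]
    congr 1; push_cast; ring
  · refine (integrableOn_inv_rpow hs.1 one_pos).congr_fun ?_ measurableSet_Ioi
    intro z hz
    have : 1 ≤ z ^ 2 := one_le_pow₀ (le_of_lt hz)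
    simp only [min_eq_left this]

theorem aestronglyMeasurable_secondDiff_div {u : ℝ → ℝ} (hu : Continuous u) (s x c : ℝ) :
    AEStronglyMeasurable (fun z => secondDiff u x (c * z) / z ^ (1 + 2 * s))
      (volume.restrict (Ioi 0)) :=
  ((continuous_secondDiff hu x c).measurable.div
    (measurable_id.pow_const _)).aestronglyMeasurable

theorem min_one_sq_mul_le (c w : ℝ) : min 1 ((c * w) ^ 2) ≤ max 1 (c ^ 2) * min 1 (w ^ 2) := by
  rw [mul_min_of_nonneg _ _ (by positivity), mul_pow]
  refine min_le_min (by simp) ?_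
  gcongr
  exact le_max_right _ _

theorem norm_secondDiff_div_le {u : ℝ → ℝ} (hu : ContDiff ℝ ∞ u) {A B : ℝ}
    (hA : ∀ x, |u x| ≤ A) (hB : ∀ x, |deriv (deriv u) x| ≤ B) (s x : ℝ) {c w : ℝ} (hc : 0 ≤ c)
    (hw : 0 < w) :
    ‖secondDiff u x (c * w) / w ^ (1 + 2 * s)‖ ≤
      (4 * A + 2 * B) * max 1 (c ^ 2) * (min 1 (w ^ 2) / w ^ (1 + 2 * s)) := by
  have hA0 : 0 ≤ A := (abs_nonneg _).trans (hA 0)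
  have hB0 : 0 ≤ B := (abs_nonneg _).trans (hB 0)
  rw [norm_div, Real.norm_eq_abs, Real.norm_of_nonneg (Real.rpow_nonneg hw.le _), ← mul_div_assoc]
  gcongr
  refine (abs_secondDiff_le_min hu hA hB x (by positivity)).trans ?_
  rw [mul_assoc]
  gcongr
  exact min_one_sq_mul_le c w

theorem integrableOn_secondDiff_div {s : ℝ} (hs : s ∈ Ioo (0 : ℝ) 1) {u : ℝ → ℝ}
    (hu : ContDiff ℝ ∞ u) {A B : ℝ} (hA : ∀ x, |u x| ≤ A) (hB : ∀ x, |deriv (deriv u) x| ≤ B)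
    (x : ℝ) {c : ℝ} (hc : 0 ≤ c) :
    IntegrableOn (fun z => secondDiff u x (c * z) / z ^ (1 + 2 * s)) (Ioi 0) := by
  refine Integrable.mono' ((integrableOn_min_kernel hs).const_mul
      ((4 * A + 2 * B) * max 1 (c ^ 2)))
    (aestronglyMeasurable_secondDiff_div hu.continuous s x c) ?_
  filter_upwards [ae_restrict_mem measurableSet_Ioi] with w hw
  exact norm_secondDiff_div_le hu hA hB s x hc hw

theorem abs_symmFracLap_le {s : ℝ} (hs : s ∈ Ioo (0 : ℝ) 1) {u : ℝ → ℝ}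
    (hu : ContDiff ℝ ∞ u) {A B : ℝ} (hA : ∀ x, |u x| ≤ A) (hB : ∀ x, |deriv (deriv u) x| ≤ B) :
    ∃ K, ∀ x, |symmFracLap s u x| ≤ K := by
  refine ⟨∫ w in Ioi (0 : ℝ), (4 * A + 2 * B) * max 1 (1 ^ 2) * (min 1 (w ^ 2) / w ^ (1 + 2 * s)),
    fun x => norm_integral_le_of_norm_le (f := fun z => secondDiff u x z / z ^ (1 + 2 * s)) ((integrableOn_min_kernel hs).const_mul _) ?_⟩
  filter_upwards [ae_restrict_mem measurableSet_Ioi] with w hw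
  simpa using norm_secondDiff_div_le hu hA hB s x zero_le_one hw

/-! ### Commutation with d/dx and with x d/dx -/

/-- The fractional Laplacian commutes with differentiation. -/
theorem hasDerivAt_symmFracLap {s : ℝ} (hs : s ∈ Ioo (0 : ℝ) 1) {u : ℝ → ℝ}
    (hu : ContDiff ℝ ∞ u) {A B A' B' : ℝ} (hA : ∀ x, |u x| ≤ A)
    (hB : ∀ x, |deriv (deriv u) x| ≤ B) (hA' : ∀ x, |deriv u x| ≤ A')
    (hB' : ∀ x, |deriv (deriv (deriv u)) x| ≤ B') (x : ℝ) :
    HasDerivAt (symmFracLap s u) (symmFracLap s (deriv u) x) x := by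
  have hu1 : Differentiable ℝ u := hu.differentiable (by simp)
  have hu' : ContDiff ℝ ∞ (deriv u) := (contDiff_infty_iff_deriv.1 hu).2
  have hone : ∀ (v : ℝ → ℝ) (y : ℝ), (fun z => secondDiff v y z / z ^ (1 + 2 * s)) =
      fun z => secondDiff v y (1 * z) / z ^ (1 + 2 * s) := by simp
  refine (hasDerivAt_integral_of_dominated_loc_of_deriv_le (s := univ)
    (F := fun y z => secondDiff u y z / z ^ (1 + 2 * s))
    (F' := fun y z => secondDiff (deriv u) y z / z ^ (1 + 2 * s)) (x₀ := x)
    (bound := fun w => (4 * A' + 2 * B') * max 1 (1 ^ 2) * (min 1 (w ^ 2) / w ^ (1 + 2 * s)))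
    univ_mem ?_ ?_ ?_ ?_ ((integrableOn_min_kernel hs).const_mul _) ?_).2
  · refine Eventually.of_forall fun y => ?_
    rw [hone]
    exact aestronglyMeasurable_secondDiff_div hu.continuous s y 1
  · rw [hone]
    exact integrableOn_secondDiff_div hs hu hA hB x zero_le_one
  · rw [hone]
    exact aestronglyMeasurable_secondDiff_div hu'.continuous s x 1
  · filter_upwards [ae_restrict_mem measurableSet_Ioi] with w hw y _
    simpa using norm_secondDiff_div_le hu' hA' hB' s y zero_le_one hw
  · refine Eventually.of_forall fun w y _ => HasDerivAt.div_const ?_ _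
    exact (((hu1 (y + w)).hasDerivAt.comp_add_const y w).add
      ((hu1 (y - w)).hasDerivAt.comp_sub_const y w)).sub ((hu1 y).hasDerivAt.const_mul 2)

/-- In the dilated form, the fractional Laplacian commutes with the Euler operator. -/
theorem hasDerivAt_scaledFracLap {s : ℝ} (hs : s ∈ Ioo (0 : ℝ) 1) {u : ℝ → ℝ}
    (hu : ContDiff ℝ ∞ u) (hE : ContDiff ℝ ∞ (eulerOp u)) {A B A' B' : ℝ} (hA : ∀ x, |u x| ≤ A)
    (hB : ∀ x, |deriv (deriv u) x| ≤ B) (hA' : ∀ x, |eulerOp u x| ≤ A')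
    (hB' : ∀ x, |deriv (deriv (eulerOp u)) x| ≤ B') {x : ℝ} (hx : 0 < x) :
    HasDerivAt (scaledFracLap s u) (x⁻¹ * scaledFracLap s (eulerOp u) x) x := by
  have hu1 : Differentiable ℝ u := hu.differentiable (by simp)
  have hA0 : 0 ≤ A' := (abs_nonneg _).trans (hA' 0)
  have hB0 : 0 ≤ B' := (abs_nonneg _).trans (hB' 0)
  rw [scaledFracLap, ← integral_const_mul]
  -- Staying in (x/2, 2x) keeps both y⁻¹ and the dilation factor max 1 y² bounded.
  refine (hasDerivAt_integral_of_dominated_loc_of_deriv_le (s := Ioo (x / 2) (2 * x))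
    (F := fun y w => secondDiff u y (y * w) / w ^ (1 + 2 * s))
    (F' := fun y w => y⁻¹ * (secondDiff (eulerOp u) y (y * w) / w ^ (1 + 2 * s))) (x₀ := x)
    (bound := fun w => (x / 2)⁻¹ * ((4 * A' + 2 * B') * max 1 ((2 * x) ^ 2) *
      (min 1 (w ^ 2) / w ^ (1 + 2 * s))))
    (Ioo_mem_nhds (by linarith) (by linarith)) ?_ ?_ ?_ ?_
    (((integrableOn_min_kernel hs).const_mul _).const_mul _) ?_).2
  · exact Eventually.of_forall fun y => aestronglyMeasurable_secondDiff_div hu.continuous s y y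
  · exact integrableOn_secondDiff_div hs hu hA hB x hx.le
  · exact (aestronglyMeasurable_secondDiff_div hE.continuous s x x).const_mul _
  · filter_upwards [ae_restrict_mem measurableSet_Ioi] with w hw y hy
    have hw : 0 < w := hw
    have hy0 : 0 < y := by linarith [hy.1]
    rw [norm_mul, Real.norm_of_nonneg (inv_nonneg.2 hy0.le)]
    have h2 : (0 : ℝ) ≤ min 1 (w ^ 2) := by positivity
    gcongr
    · exact hy.1.le
    · refine (norm_secondDiff_div_le hE hA' hB' s y hy0.le hw).trans ?_
      gcongr
      exact hy.2.le
  · refine Eventually.of_forall fun w y hy => ?_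
    have hy0 : y ≠ 0 := by linarith [hy.1] |> fun h : 0 < y => h.ne'
    have h1 := (hu1 (y + y * w)).hasDerivAt.comp y
      ((hasDerivAt_id y).add ((hasDerivAt_id y).mul_const w))
    have h2 := (hu1 (y - y * w)).hasDerivAt.comp y
      ((hasDerivAt_id y).sub ((hasDerivAt_id y).mul_const w))
    have h3 := ((h1.add h2).sub ((hu1 y).hasDerivAt.const_mul 2)).div_const (w ^ (1 + 2 * s))
    -- The chain rule factors 1 ± w are y⁻¹ (y ± y w), which turns each u' into y⁻¹ E u at the same
    -- point.
    refine h3.congr_deriv ?_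
    simp only [secondDiff, eulerOp]
    rw [← mul_div_assoc]
    congr 1
    field_simp

theorem scaledFracLap_eq (s : ℝ) (u : ℝ → ℝ) {x : ℝ} (hx : 0 < x) :
    scaledFracLap s u x = x ^ (2 * s) * symmFracLap s u x := by
  have h := integral_comp_mul_left_Ioi (fun z => secondDiff u x z / z ^ (1 + 2 * s)) 0 hx
  rw [mul_zero, smul_eq_mul] at h
  have h' : symmFracLap s u x =
      x * ∫ w in Ioi (0 : ℝ), secondDiff u x (x * w) / (x * w) ^ (1 + 2 * s) := by
    rw [h, mul_inv_cancel_left₀ hx.ne', symmFracLap]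
  rw [h', ← mul_assoc, ← integral_const_mul, scaledFracLap]
  refine setIntegral_congr_fun measurableSet_Ioi fun w hw => ?_
  have hw : 0 < w := hw
  have h1 : x ^ (2 * s) * x = x ^ (1 + 2 * s) := by
    rw [add_comm, Real.rpow_add_one hx.ne']
  have h2 := (Real.rpow_pos_of_pos hx (1 + 2 * s)).ne'
  have h3 := (Real.rpow_pos_of_pos hw (1 + 2 * s)).ne'
  simp only [h1, Real.mul_rpow hx.le hw.le]
  field_simp

/-! ### The principal value as a symmetrised integral -/

theorem setOf_le_abs_sub (x ε : ℝ) :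
    {y : ℝ | ε ≤ |x - y|} = Iic (x - ε) ∪ Ici (x + ε) := by
  ext y
  simp only [mem_ofPred_eq, mem_union, mem_Iic, mem_Ici, le_abs]
  constructor <;> rintro (h | h)
  · left; linarith
  · right; linarith
  · left; linarith
  · right; linarith

theorem integrableOn_sub_div {s : ℝ} (hs : 0 < s) {v : ℝ → ℝ} (hv : Continuous v) {A : ℝ}
    (hA : ∀ z, |v z| ≤ A) {ε : ℝ} (hε : 0 < ε) :
    IntegrableOn (fun z => v z / z ^ (1 + 2 * s)) (Ici ε) := by
  rw [integrableOn_Ici_iff_integrableOn_Ioi]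
  simp only [div_eq_mul_one_div (v _)]
  exact (integrableOn_inv_rpow hs hε).bdd_mul hv.aestronglyMeasurable
    (Eventually.of_forall hA)

/-- Translation and reflection carry the two half-lines y ≥ x + ε and y ≤ x - ε onto z ≥ ε; the two
integrands then add up to a second difference. -/
theorem fracLapTrunc_eq {s : ℝ} (hs : 0 < s) {u : ℝ → ℝ} (hu : Continuous u) {A : ℝ}
    (hA : ∀ x, |u x| ≤ A) (x : ℝ) {ε : ℝ} (hε : 0 < ε) :
    IntegrableOn (fracLapIntegrand s u x) {y : ℝ | ε ≤ |x - y|} ∧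
      fracLapTrunc s u x ε = ∫ z in Ici ε, secondDiff u x z / z ^ (1 + 2 * s) := by
  have hbd : ∀ a b, |u a - u b| ≤ 2 * A := fun a b =>
    (abs_sub _ _).trans (by linarith [hA a, hA b])
  have hr := measurePreserving_add_left (volume : Measure ℝ) x
  have hl := Measure.measurePreserving_sub_left (volume : Measure ℝ) x
  have er : MeasurableEmbedding (fun z : ℝ => x + z) := (MeasurableEquiv.addLeft x).measurableEmbedding
  have el : MeasurableEmbedding (fun z : ℝ => x - z) := (MeasurableEquiv.subLeft x).measurableEmbedding
  have pr : (fun z : ℝ => x + z) ⁻¹' Ici (x + ε) = Ici ε := by ext; simp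
  have pl : (fun z : ℝ => x - z) ⁻¹' Iic (x - ε) = Ici ε := by ext; simp
  have cr : EqOn (fun z => (u (x + z) - u x) / z ^ (1 + 2 * s))
      (fun z => fracLapIntegrand s u x (x + z)) (Ici ε) := by
    intro z hz
    have : 0 ≤ z := hε.le.trans hz
    simp [fracLapIntegrand, abs_of_nonneg this]
  have cl : EqOn (fun z => (u (x - z) - u x) / z ^ (1 + 2 * s))
      (fun z => fracLapIntegrand s u x (x - z)) (Ici ε) := by
    intro z hz
    have : 0 ≤ z := hε.le.trans hz
    simp [fracLapIntegrand, abs_of_nonneg this]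
  have ir := integrableOn_sub_div hs (v := fun z => u (x + z) - u x) (by fun_prop)
    (fun z => hbd _ _) hε
  have il := integrableOn_sub_div hs (v := fun z => u (x - z) - u x) (by fun_prop)
    (fun z => hbd _ _) hε
  have Ir : IntegrableOn (fracLapIntegrand s u x) (Ici (x + ε)) := by
    rw [← hr.integrableOn_comp_preimage er, pr]
    exact ir.congr_fun cr measurableSet_Ici
  have Il : IntegrableOn (fracLapIntegrand s u x) (Iic (x - ε)) := by
    rw [← hl.integrableOn_comp_preimage el, pl]
    exact il.congr_fun cl measurableSet_Ici
  rw [fracLapTrunc, setOf_le_abs_sub x ε]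
  refine ⟨Il.union Ir, ?_⟩
  rw [setIntegral_union (Iic_disjoint_Ici.2 (by linarith)) measurableSet_Ici Il Ir,
    ← hr.setIntegral_preimage_emb er _ (Ici (x + ε)),
    ← hl.setIntegral_preimage_emb el _ (Iic (x - ε)), pr, pl,
    ← setIntegral_congr_fun measurableSet_Ici cr, ← setIntegral_congr_fun measurableSet_Ici cl,
    ← integral_add il ir]
  congr 1 with z
  rw [secondDiff]
  ring

theorem tendsto_fracLapTrunc {s : ℝ} (hs : s ∈ Ioo (0 : ℝ) 1) {u : ℝ → ℝ} (hu : ContDiff ℝ ∞ u)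
    {A B : ℝ} (hA : ∀ x, |u x| ≤ A) (hB : ∀ x, |deriv (deriv u) x| ≤ B) (x : ℝ) :
    Tendsto (fracLapTrunc s u x) (𝓝[>] 0) (𝓝 (symmFracLap s u x)) := by
  have hi : IntegrableOn (fun z => secondDiff u x z / z ^ (1 + 2 * s)) (Ioi 0) := by
    simpa using integrableOn_secondDiff_div hs hu hA hB x zero_le_one
  have hc := aecover_Ioi_of_Ici (μ := volume) (l := 𝓝[>] (0 : ℝ)) (a := fun ε => ε) (A := 0)
    (tendsto_nhdsWithin_of_tendsto_nhds tendsto_id)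
  refine (hc.integral_tendsto_of_countably_generated hi).congr' ?_
  filter_upwards [self_mem_nhdsWithin] with ε hε
  have hε : 0 < ε := hε
  rw [(fracLapTrunc_eq hs.1 hu.continuous hA x hε).2, Measure.restrict_restrict measurableSet_Ici,
    inter_eq_left.2 (Ici_subset_Ioi.2 hε)]

theorem fracLapConverges_of_bounded {s : ℝ} (hs : s ∈ Ioo (0 : ℝ) 1) {u : ℝ → ℝ}
    (hu : ContDiff ℝ ∞ u) {A B : ℝ} (hA : ∀ x, |u x| ≤ A) (hB : ∀ x, |deriv (deriv u) x| ≤ B)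
    (x : ℝ) : FracLapConverges s u x :=
  ⟨fun _ hε => (fracLapTrunc_eq hs.1 hu.continuous hA x hε).1, _,
    tendsto_fracLapTrunc hs hu hA hB x⟩

theorem fracLap_eq_symmFracLap {s : ℝ} (hs : s ∈ Ioo (0 : ℝ) 1) {u : ℝ → ℝ}
    (hu : ContDiff ℝ ∞ u) {A B : ℝ} (hA : ∀ x, |u x| ≤ A) (hB : ∀ x, |deriv (deriv u) x| ≤ B) :
    fracLap s u = symmFracLap s u :=
  funext fun x => (tendsto_fracLapTrunc hs hu hA hB x).limUnder_eq

/-! ### Functions with power tails -/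

/-- `u` agrees with `b + d x^(-β)` for large positive `x`. -/
def HasPowerTail (β : ℝ) (u : ℝ → ℝ) : Prop :=
  ∃ b d : ℝ, ∀ᶠ x in atTop, u x = b + d * x ^ (-β)

theorem HasPowerTail.linear_comb {β : ℝ} {u v : ℝ → ℝ} (hu : HasPowerTail β u)
    (hv : HasPowerTail β v) (p q : ℝ) : HasPowerTail β fun x => p * u x + q * v x := by
  obtain ⟨b, d, h⟩ := hu
  obtain ⟨b', d', h'⟩ := hv
  refine ⟨p * b + q * b', p * d + q * d', ?_⟩
  filter_upwards [h, h'] with x h1 h2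
  rw [h1, h2]; ring

theorem HasPowerTail.deriv {β : ℝ} {u : ℝ → ℝ} (hu : HasPowerTail β u) :
    HasPowerTail (β + 1) (deriv u) := by
  obtain ⟨b, d, h⟩ := hu
  obtain ⟨N, hN⟩ := eventually_atTop.1 h
  refine ⟨0, d * -β, ?_⟩
  filter_upwards [eventually_gt_atTop N, eventually_gt_atTop 0] with x hx hx0
  have : u =ᶠ[𝓝 x] fun y => b + d * y ^ (-β) := by
    filter_upwards [Ioi_mem_nhds hx] with y hy using hN y (le_of_lt hy)
  rw [this.deriv_eq, (((Real.hasDerivAt_rpow_const (Or.inl hx0.ne')).const_mul d).const_add b).deriv]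
  rw [show -β - 1 = -(β + 1) by ring]
  ring

/-- Unlike d/dx, which raises the exponent, x d/dx only rescales x^(-β), so it can be iterated
within one class. -/
theorem HasPowerTail.eulerOp {β : ℝ} {u : ℝ → ℝ} (hu : HasPowerTail β u) :
    HasPowerTail β (eulerOp u) := by
  obtain ⟨b, d, h⟩ := hu
  obtain ⟨N, hN⟩ := eventually_atTop.1 h
  refine ⟨0, d * -β, ?_⟩
  filter_upwards [eventually_gt_atTop N, eventually_gt_atTop 0] with x hx hx0
  have : u =ᶠ[𝓝 x] fun y => b + d * y ^ (-β) := by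
    filter_upwards [Ioi_mem_nhds hx] with y hy using hN y (le_of_lt hy)
  rw [_root_.eulerOp, this.deriv_eq,
    (((Real.hasDerivAt_rpow_const (Or.inl hx0.ne')).const_mul d).const_add b).deriv,
    Real.rpow_sub_one hx0.ne']
  field_simp
  ring

theorem HasPowerTail.tendsto {β : ℝ} (hβ : 0 < β) {u : ℝ → ℝ} (hu : HasPowerTail β u) :
    ∃ b, Tendsto u atTop (𝓝 b) := by
  obtain ⟨b, d, h⟩ := hu
  refine ⟨b, Tendsto.congr' (h.mono fun x hx => hx.symm) ?_⟩
  simpa using ((tendsto_rpow_neg_atTop hβ).const_mul d).const_add b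

/-- Smooth functions with explicit power tails at both ends. -/
structure PowerTails (α β : ℝ) (u : ℝ → ℝ) : Prop where
  contDiff : ContDiff ℝ ∞ u
  right : HasPowerTail β u
  left : HasPowerTail α fun x => u (-x)

namespace PowerTails

variable {α β : ℝ} {u v : ℝ → ℝ}

theorem reflect (hu : PowerTails α β u) : PowerTails β α fun x => u (-x) :=
  ⟨hu.contDiff.comp contDiff_neg, hu.left, by simpa using hu.right⟩

theorem linear_comb (hu : PowerTails α β u) (hv : PowerTails α β v) (p q : ℝ) :
    PowerTails α β fun x => p * u x + q * v x :=
  ⟨(contDiff_const.mul hu.contDiff).add (contDiff_const.mul hv.contDiff),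
    hu.right.linear_comb hv.right p q, hu.left.linear_comb hv.left p q⟩

theorem deriv (hu : PowerTails α β u) : PowerTails (α + 1) (β + 1) (deriv u) := by
  refine ⟨(contDiff_infty_iff_deriv.1 hu.contDiff).2, hu.right.deriv, ?_⟩
  have h := hu.left.deriv
  -- The combination only supplies the sign of (u(-x))' = -u'(-x).
  have := h.linear_comb h (-1) 0
  simpa [deriv_comp_neg] using this

theorem eulerOp (hu : PowerTails α β u) : PowerTails α β (eulerOp u) := by
  refine ⟨contDiff_id.mul (contDiff_infty_iff_deriv.1 hu.contDiff).2, hu.right.eulerOp, ?_⟩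
  have h : (fun x => _root_.eulerOp u (-x)) = _root_.eulerOp fun x => u (-x) := by
    ext x
    simp [_root_.eulerOp, deriv_comp_neg]
  rw [h]
  exact hu.left.eulerOp

theorem exists_bound (hα : 0 < α) (hβ : 0 < β) (hu : PowerTails α β u) :
    ∃ A, ∀ x, |u x| ≤ A := by
  obtain ⟨b, hb⟩ := hu.right.tendsto hβ
  obtain ⟨a, ha⟩ := hu.left.tendsto hα
  obtain ⟨N, hN⟩ := eventually_atTop.1 (hb.abs.eventually_le_const (lt_add_one _))
  obtain ⟨M, hM⟩ := eventually_atTop.1 (ha.abs.eventually_le_const (lt_add_one _))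
  obtain ⟨K, hK⟩ := isCompact_Icc.exists_bound_of_continuousOn (s := Icc (-M) N)
    hu.contDiff.continuous.continuousOn
  refine ⟨max K (max (|b| + 1) (|a| + 1)), fun x => ?_⟩
  rcases le_total N x with h | h
  · exact (hN x h).trans (le_max_of_le_right (le_max_left _ _))
  rcases le_total x (-M) with h' | h'
  · have := hM (-x) (by linarith)
    rw [neg_neg] at this
    exact this.trans (le_max_of_le_right (le_max_right _ _))
  · exact (hK x ⟨h', h⟩).trans (le_max_left _ _)

theorem exists_bound_deriv_deriv (hα : 0 < α) (hβ : 0 < β) (hu : PowerTails α β u) :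
    ∃ B, ∀ x, |_root_.deriv (_root_.deriv u) x| ≤ B :=
  hu.deriv.deriv.exists_bound (by linarith) (by linarith)

/-- This is x² D² = E² - E, with coefficients written in the shape of `linear_comb`, so that
boundedness of the class gives u'' = O(x⁻²). -/
theorem sq_mul_deriv_deriv (hu : PowerTails α β u) (x : ℝ) :
    x ^ 2 * _root_.deriv (_root_.deriv u) x =
      1 * _root_.eulerOp (_root_.eulerOp u) x + -1 * _root_.eulerOp u x := by
  have h2 := hu.deriv.contDiff.differentiable (by simp) x
  have : _root_.deriv (_root_.eulerOp u) x =
      1 * _root_.deriv u x + x * _root_.deriv (_root_.deriv u) x :=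
    ((hasDerivAt_id x).mul h2.hasDerivAt).deriv
  rw [_root_.eulerOp, this, _root_.eulerOp]
  ring

theorem exists_bound_sq_mul (hα : 0 < α) (hβ : 0 < β) (hu : PowerTails α β u) :
    ∃ B, ∀ x, x ^ 2 * |_root_.deriv (_root_.deriv u) x| ≤ B := by
  obtain ⟨B, hB⟩ := (hu.eulerOp.eulerOp.linear_comb hu.eulerOp 1 (-1)).exists_bound hα hβ
  refine ⟨B, fun x => ?_⟩
  rw [← abs_of_nonneg (sq_nonneg x), ← abs_mul, hu.sq_mul_deriv_deriv]
  exact hB x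

theorem contDiff_symmFracLap {s : ℝ} (hs : s ∈ Ioo (0 : ℝ) 1) (hα : 0 < α) (hβ : 0 < β)
    (hu : PowerTails α β u) : ContDiff ℝ ∞ (symmFracLap s u) := by
  rw [contDiff_infty]
  intro n
  -- The exponents vary with u because each derivative shifts both by one.
  induction n generalizing α β u with
  | zero =>
    obtain ⟨A, hA⟩ := hu.exists_bound hα hβ
    obtain ⟨B, hB⟩ := hu.exists_bound_deriv_deriv hα hβ
    obtain ⟨A', hA'⟩ := hu.deriv.exists_bound (by linarith) (by linarith)
    obtain ⟨B', hB'⟩ := hu.deriv.exists_bound_deriv_deriv (by linarith) (by linarith)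
    rw [Nat.cast_zero, contDiff_zero, continuous_iff_continuousAt]
    exact fun x => (hasDerivAt_symmFracLap hs hu.contDiff hA hB hA' hB' x).continuousAt
  | succ n ih =>
    obtain ⟨A, hA⟩ := hu.exists_bound hα hβ
    obtain ⟨B, hB⟩ := hu.exists_bound_deriv_deriv hα hβ
    obtain ⟨A', hA'⟩ := hu.deriv.exists_bound (by linarith) (by linarith)
    obtain ⟨B', hB'⟩ := hu.deriv.exists_bound_deriv_deriv (by linarith) (by linarith)
    have h := hasDerivAt_symmFracLap hs hu.contDiff hA hB hA' hB'
    rw [Nat.cast_succ, contDiff_succ_iff_deriv]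
    refine ⟨fun x => (h x).differentiableAt, by simp, ?_⟩
    rw [funext fun x => (h x).deriv]
    exact ih (by linarith) (by linarith) hu.deriv

theorem hasDerivAt_scaledFracLap {s : ℝ} (hs : s ∈ Ioo (0 : ℝ) 1) (hα : 0 < α) (hβ : 0 < β)
    (hu : PowerTails α β u) {x : ℝ} (hx : 0 < x) :
    HasDerivAt (scaledFracLap s u) (x⁻¹ * scaledFracLap s (_root_.eulerOp u) x) x := by
  obtain ⟨A, hA⟩ := hu.exists_bound hα hβ
  obtain ⟨B, hB⟩ := hu.exists_bound_deriv_deriv hα hβ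
  obtain ⟨A', hA'⟩ := hu.eulerOp.exists_bound hα hβ
  obtain ⟨B', hB'⟩ := hu.eulerOp.exists_bound_deriv_deriv hα hβ
  exact _root_.hasDerivAt_scaledFracLap hs hu.contDiff hu.eulerOp.contDiff hA hB hA' hB' hx

theorem scaledFracLap_linear_comb {s : ℝ} (hs : s ∈ Ioo (0 : ℝ) 1) (hα : 0 < α) (hβ : 0 < β)
    (hu : PowerTails α β u) (hv : PowerTails α β v) (p q : ℝ) {x : ℝ} (hx : 0 < x) :
    scaledFracLap s (fun x => p * u x + q * v x) x =
      p * scaledFracLap s u x + q * scaledFracLap s v x := by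
  obtain ⟨A, hA⟩ := hu.exists_bound hα hβ
  obtain ⟨B, hB⟩ := hu.exists_bound_deriv_deriv hα hβ
  obtain ⟨A', hA'⟩ := hv.exists_bound hα hβ
  obtain ⟨B', hB'⟩ := hv.exists_bound_deriv_deriv hα hβ
  simp only [scaledFracLap]
  rw [← integral_const_mul, ← integral_const_mul, ← integral_add
    ((integrableOn_secondDiff_div hs hu.contDiff hA hB x hx.le).const_mul p)
    ((integrableOn_secondDiff_div hs hv.contDiff hA' hB' x hx.le).const_mul q)]
  congr 1 with w
  simp only [secondDiff]
  ring

theorem tendsto_scaledFracLap {s : ℝ} (hs : s ∈ Ioo (0 : ℝ) 1) (hα : 0 < α) (hβ : 0 < β)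
    (hu : PowerTails α β u) : ∃ l, Tendsto (scaledFracLap s u) atTop (𝓝 l) := by
  obtain ⟨A, hA⟩ := hu.exists_bound hα hβ
  obtain ⟨B, hB⟩ := hu.exists_bound_sq_mul hα hβ
  obtain ⟨b, hb⟩ := hu.right.tendsto hβ
  obtain ⟨a, ha⟩ := hu.left.tendsto hα
  have hA0 : 0 ≤ A := (abs_nonneg _).trans (hA 0)
  have hB0 : 0 ≤ B := (mul_nonneg (sq_nonneg _) (abs_nonneg _)).trans (hB 0)
  -- For w ≤ 1/2 the points lie in y ≥ x/2, where |u''| ≤ 4B/x², and the bound 8 B w² is free of x.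
  -- For w ≥ 1/2, min 1 w² ≥ 1/4 and the trivial bound 4A suffices.
  have key : ∀ x > 0, ∀ w > 0, |secondDiff u x (x * w)| ≤ (16 * A + 8 * B) * min 1 (w ^ 2) := by
    intro x hx w hw
    have h1 := abs_secondDiff_le_of_bound hA x (x * w)
    rcases le_total w (1 / 2) with h | h
    · have h2 := abs_secondDiff_le_sq hu.contDiff (x := x) (z := x * w) (B := 4 * B / x ^ 2)
        (by positivity) fun y hy => by
          have hy' : x / 2 ≤ y := by nlinarith [hy.1]
          rw [le_div_iff₀ (by positivity)]
          have := hB y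
          have h3 : x ^ 2 ≤ 4 * y ^ 2 := by nlinarith
          nlinarith [abs_nonneg (_root_.deriv (_root_.deriv u) y)]
      have h4 : w ^ 2 ≤ 1 := by nlinarith
      have h5 : 2 * (4 * B / x ^ 2) * (x * w) ^ 2 = 8 * B * w ^ 2 := by field_simp; ring
      rw [min_eq_right h4]
      rw [h5] at h2
      nlinarith [sq_nonneg w]
    · have h4 : 1 / 4 ≤ min 1 (w ^ 2) := le_min (by norm_num) (by nlinarith)
      nlinarith
  -- As x → ∞, x + x w tends to +∞, while x - x w tends to +∞ or -∞ according as w < 1 or w > 1; w =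
  -- 1 is a null set.
  refine ⟨∫ w in Ioi (0 : ℝ), ((b + (if w < 1 then b else a) - 2 * b) / w ^ (1 + 2 * s)), ?_⟩
  refine tendsto_integral_filter_of_dominated_convergence
    (fun w => (16 * A + 8 * B) * (min 1 (w ^ 2) / w ^ (1 + 2 * s))) ?_ ?_
    ((integrableOn_min_kernel hs).const_mul _) ?_
  · exact Eventually.of_forall fun x =>
      aestronglyMeasurable_secondDiff_div hu.contDiff.continuous s x x
  · filter_upwards [eventually_gt_atTop 0] with x hx
    filter_upwards [ae_restrict_mem measurableSet_Ioi] with w hw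
    have hw : 0 < w := hw
    rw [norm_div, Real.norm_eq_abs, Real.norm_of_nonneg (Real.rpow_nonneg hw.le _),
      ← mul_div_assoc]
    gcongr
    exact key x hx w hw
  · have hne : ∀ᵐ w ∂(volume.restrict (Ioi (0 : ℝ))), w ≠ 1 :=
      ae_restrict_of_ae (Measure.ae_ne volume 1)
    filter_upwards [ae_restrict_mem measurableSet_Ioi, hne] with w hw hw1
    have hw : 0 < w := hw
    refine Tendsto.div_const ((Tendsto.add ?_ ?_).sub (hb.const_mul 2)) _
    · refine hb.comp ?_
      simp only [← mul_one_add]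
      exact tendsto_id.atTop_mul_const (by linarith)
    · split_ifs with h
      · refine hb.comp ?_
        simp only [← mul_one_sub]
        exact tendsto_id.atTop_mul_const (by linarith)
      · have h' : 1 < w := lt_of_le_of_ne (not_lt.1 h) (Ne.symm hw1)
        have h2 : Tendsto (fun x : ℝ => x * (w - 1)) atTop atTop :=
          tendsto_id.atTop_mul_const (by linarith)
        refine (ha.comp h2).congr fun x => ?_
        simp only [Function.comp]
        congr 1; ring

end PowerTails

/-! ### Derivatives along the curve t = C x^(-β) -/

theorem tendsto_div_rpow_neg_inv {β C : ℝ} (hβ : 0 < β) (hC : 0 < C) :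
    Tendsto (fun t : ℝ => (t / C) ^ (-β⁻¹)) (𝓝[>] 0) atTop := by
  refine (tendsto_rpow_neg_nhdsGT_zero (neg_lt_zero.2 (inv_pos.2 hβ))).comp ?_
  refine tendsto_nhdsWithin_iff.2 ⟨?_, ?_⟩
  · refine tendsto_nhdsWithin_of_tendsto_nhds ?_
    exact Continuous.tendsto' (by fun_prop) _ _ (by simp)
  · filter_upwards [self_mem_nhdsWithin] with t ht using div_pos ht hC

theorem mul_rpow_neg_inv_rpow {β C t : ℝ} (hβ : 0 < β) (hC : 0 < C) (ht : 0 < t) :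
    C * ((t / C) ^ (-β⁻¹)) ^ (-β) = t := by
  rw [← Real.rpow_mul (div_pos ht hC).le, neg_mul_neg, inv_mul_cancel₀ hβ.ne', Real.rpow_one,
    mul_div_cancel₀ _ hC.ne']

namespace PowerTails

variable {α β : ℝ} {u : ℝ → ℝ}

/-- Dilated fractional Laplacians times powers, along `x = (t / C) ^ (-1 / β)`, are stable under
differentiation in `t`. -/
theorem hasDerivAt_rpow_mul_scaledFracLap {s : ℝ} (hs : s ∈ Ioo (0 : ℝ) 1) (hα : 0 < α)
    (hβ : 0 < β) (hu : PowerTails α β u) {C : ℝ} (hC : 0 < C) (q : ℝ) {t : ℝ} (ht : 0 < t) :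
    HasDerivAt (fun t => t ^ q * scaledFracLap s u ((t / C) ^ (-β⁻¹)))
      (t ^ (q - 1) * scaledFracLap s (fun x => q * u x + -β⁻¹ * _root_.eulerOp u x)
        ((t / C) ^ (-β⁻¹))) t := by
  have htC : 0 < t / C := div_pos ht hC
  have hy := Real.rpow_pos_of_pos htC (-β⁻¹)
  have h1 := ((hasDerivAt_id t).div_const C).rpow_const (p := -β⁻¹) (Or.inl htC.ne')
  have h2 := (hu.hasDerivAt_scaledFracLap hs hα hβ hy).comp t h1
  have h3 := (Real.hasDerivAt_rpow_const (p := q) (Or.inl ht.ne')).mul h2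
  refine h3.congr_deriv ?_
  rw [hu.scaledFracLap_linear_comb hs hα hβ hu.eulerOp _ _ hy]
  simp only [id, Function.comp]
  rw [Real.rpow_sub_one htC.ne', Real.rpow_sub_one ht.ne']
  field_simp

theorem exists_iteratedDeriv_eq {s : ℝ} (hs : s ∈ Ioo (0 : ℝ) 1) (hα : 0 < α)
    (hβ : 0 < β) (hu : PowerTails α β u) {C : ℝ} (hC : 0 < C) (q : ℝ) (i : ℕ) :
    ∃ v, PowerTails α β v ∧ ∀ t > 0,
      iteratedDeriv i (fun t => t ^ q * scaledFracLap s u ((t / C) ^ (-β⁻¹))) t =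
        t ^ (q - i) * scaledFracLap s v ((t / C) ^ (-β⁻¹)) := by
  induction i with
  | zero => exact ⟨u, hu, by simp⟩
  | succ i ih =>
    obtain ⟨v, hv, h⟩ := ih
    refine ⟨_, hv.linear_comb hv.eulerOp (q - i) (-β⁻¹), fun t ht => ?_⟩
    have he : iteratedDeriv i (fun t => t ^ q * scaledFracLap s u ((t / C) ^ (-β⁻¹))) =ᶠ[𝓝 t]
        fun t => t ^ (q - i) * scaledFracLap s v ((t / C) ^ (-β⁻¹)) :=
      eventually_of_mem (Ioi_mem_nhds ht) h
    rw [iteratedDeriv_succ, he.deriv_eq,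
      (hv.hasDerivAt_rpow_mul_scaledFracLap hs hα hβ hC _ ht).deriv]
    congr 2
    push_cast; ring

/-- The asymptotics, as `t → 0⁺`, of all derivatives of the fractional Laplacian along
`x = (t / C) ^ (-1 / β)`. -/
theorem tendsto_iteratedDeriv_symmFracLap {s : ℝ} (hs : s ∈ Ioo (0 : ℝ) 1) (hα : 0 < α)
    (hβ : 0 < β) (hu : PowerTails α β u) {C : ℝ} (hC : 0 < C) (i : ℕ) :
    ∃ l, Tendsto (fun t : ℝ => iteratedDeriv i (fun t => symmFracLap s u ((t / C) ^ (-β⁻¹))) t /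
      t ^ (2 * s / β - i)) (𝓝[>] 0) (𝓝 l) := by
  obtain ⟨v, hv, h⟩ := hu.exists_iteratedDeriv_eq hs hα hβ hC (2 * s / β) i
  obtain ⟨l, hl⟩ := hv.tendsto_scaledFracLap hs hα hβ
  have hy := tendsto_div_rpow_neg_inv hβ hC
  refine ⟨C ^ (-(2 * s / β)) * l, ((hl.comp hy).const_mul _).congr' ?_⟩
  filter_upwards [self_mem_nhdsWithin] with t ht
  have ht : 0 < t := ht
  have he : (fun t => symmFracLap s u ((t / C) ^ (-β⁻¹))) =ᶠ[𝓝 t] fun t =>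
      -- On the curve x^(-2s) = (t / C)^(2s/β), whence the constant.
      C ^ (-(2 * s / β)) * (t ^ (2 * s / β) * scaledFracLap s u ((t / C) ^ (-β⁻¹))) := by
    filter_upwards [Ioi_mem_nhds ht] with r hr
    have hr : 0 < r := hr
    have hrC := div_pos hr hC
    have e : C ^ (-(2 * s / β)) * (r ^ (2 * s / β) * (r / C) ^ (-(2 * s / β))) = 1 := by
      rw [Real.div_rpow hr.le hC.le, Real.rpow_neg hr.le]
      have := (Real.rpow_pos_of_pos hr (2 * s / β)).ne'
      have := (Real.rpow_pos_of_pos hC (-(2 * s / β))).ne'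
      field_simp
    rw [scaledFracLap_eq s u (Real.rpow_pos_of_pos hrC _), ← Real.rpow_mul hrC.le,
      show -β⁻¹ * (2 * s) = -(2 * s / β) by ring, ← mul_assoc (r ^ _), ← mul_assoc, e, one_mul]
  rw [he.iteratedDeriv_eq, iteratedDeriv_const_mul_field, h t ht]
  have := (Real.rpow_pos_of_pos ht (2 * s / β - i)).ne'
  simp only [Function.comp]
  field_simp

end PowerTails

/-! ### Reflection, the inverse of φ and its range -/

theorem symmFracLap_neg (s : ℝ) (u : ℝ → ℝ) (x : ℝ) :
    symmFracLap s u (-x) = symmFracLap s (fun y => u (-y)) x := by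
  simp only [symmFracLap, secondDiff]
  congr 1 with z
  rw [show -(x + z) = -x - z by ring, show -(x - z) = -x + z by ring]
  ring

/-- Injectivity forces `Function.invFun φ` to agree near φ x with the smooth local inverse. -/
theorem contDiffAt_invFun {φ : ℝ → ℝ} (hφ : ContDiff ℝ ∞ φ) (hφ' : ∀ x, 0 < deriv φ x) (x : ℝ) :
    ContDiffAt ℝ ∞ (Function.invFun φ) (φ x) := by
  have hinj : Function.Injective φ := (strictMono_of_deriv_pos hφ').injective
  have hd : HasFDerivAt φ ((ContinuousLinearEquiv.unitsEquivAut ℝ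
      (Units.mk0 (deriv φ x) (hφ' x).ne') : ℝ ≃L[ℝ] ℝ) : ℝ →L[ℝ] ℝ) x := by
    refine (hφ.differentiable (by simp) x).hasDerivAt.hasFDerivAt.congr_fderiv ?_
    ext
    simp
  refine (hφ.contDiffAt.to_localInverse hd (by simp)).congr_of_eventuallyEq ?_
  have hs := hφ.contDiffAt.hasStrictFDerivAt' hd (by simp)
  filter_upwards [hs.eventually_right_inverse] with y hy
  refine Eq.trans ?_ (Function.leftInverse_invFun hinj (hs.localInverse φ _ x y))
  rw [hy]

theorem powerTails_of_eq {α β κ C₁ C₂ : ℝ} {φ : ℝ → ℝ} (hφ : ContDiff ℝ ∞ φ)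
    (hleft : ∀ x, x < -κ → φ x = -1 + C₁ * |x| ^ (-α))
    (hright : ∀ x, κ < x → φ x = 1 - C₂ * |x| ^ (-β)) : PowerTails α β φ := by
  refine ⟨hφ, ⟨1, -C₂, ?_⟩, ⟨-1, C₁, ?_⟩⟩
  · filter_upwards [eventually_gt_atTop κ, eventually_gt_atTop 0] with x hx hx0
    rw [hright x hx, abs_of_pos hx0]; ring
  · filter_upwards [eventually_gt_atTop κ, eventually_gt_atTop 0] with x hx hx0
    rw [hleft (-x) (by linarith), abs_neg, abs_of_pos hx0]

theorem exists_eq_of_tails {α β κ C₁ C₂ : ℝ} (hα : 0 < α) (hβ : 0 < β) {φ : ℝ → ℝ} (hφ : Continuous φ)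
    (hleft : ∀ x, x < -κ → φ x = -1 + C₁ * |x| ^ (-α))
    (hright : ∀ x, κ < x → φ x = 1 - C₂ * |x| ^ (-β)) {r : ℝ} (hr : r ∈ Ioo (-1 : ℝ) 1) :
    ∃ x, φ x = r := by
  refine mem_range_of_exists_le_of_exists_ge hφ ?_ ?_
  · have h := (tendsto_rpow_neg_atTop hα).const_mul C₁
    rw [mul_zero] at h
    obtain ⟨x, h1, h2, h3⟩ := ((h.eventually_lt_const (by linarith [hr.1] : 0 < r + 1)).and
      ((eventually_gt_atTop κ).and (eventually_gt_atTop 0))).exists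
    refine ⟨-x, ?_⟩
    rw [hleft (-x) (by linarith), abs_neg, abs_of_pos h3]
    linarith
  · have h := (tendsto_rpow_neg_atTop hβ).const_mul C₂
    rw [mul_zero] at h
    obtain ⟨x, h1, h2, h3⟩ := ((h.eventually_lt_const (by linarith [hr.2] : 0 < 1 - r)).and
      ((eventually_gt_atTop κ).and (eventually_gt_atTop 0))).exists
    refine ⟨x, ?_⟩
    rw [hright x h2, abs_of_pos h3]
    linarith

/-! ### Transfer of the asymptotics to V -/

theorem tendsto_one_sub_nhdsLT : Tendsto (fun r : ℝ => 1 - r) (𝓝[<] 1) (𝓝[>] 0) := by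
  refine tendsto_nhdsWithin_iff.2 ⟨tendsto_nhdsWithin_of_tendsto_nhds
    (Continuous.tendsto' (by fun_prop) _ _ (by simp)), ?_⟩
  filter_upwards [self_mem_nhdsWithin] with r hr using sub_pos.2 (mem_Iio.1 hr)

theorem tendsto_one_add_nhdsGT : Tendsto (fun r : ℝ => 1 + r) (𝓝[>] (-1)) (𝓝[>] 0) := by
  refine tendsto_nhdsWithin_iff.2 ⟨tendsto_nhdsWithin_of_tendsto_nhds
    (Continuous.tendsto' (by fun_prop) _ _ (by simp)), ?_⟩
  filter_upwards [self_mem_nhdsWithin] with r hr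
  have hr : -1 < r := hr
  exact mem_Ioi.2 (by linarith)

/-- If `V' = h` on `(-1, 1)` and `h(r) = F(1 - r)` near `1⁻`, the asymptotics of the
derivatives of `F` at `0⁺` transfer to those of `V` at `1⁻`. -/
theorem tendsto_iteratedDeriv_succ_left {V h F : ℝ → ℝ} {i : ℕ} {p l : ℝ}
    (hV : ∀ r ∈ Ioo (-1 : ℝ) 1, HasDerivAt V (h r) r) (hF : ∀ᶠ r in 𝓝[<] 1, h r = F (1 - r))
    (hl : Tendsto (fun t : ℝ => iteratedDeriv i F t / t ^ p) (𝓝[>] 0) (𝓝 l)) :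
    Tendsto (fun r : ℝ => iteratedDeriv (i + 1) V r / (1 - r) ^ p) (𝓝[<] 1)
      (𝓝 ((-1) ^ i * l)) := by
  have ht := tendsto_one_sub_nhdsLT
  refine ((hl.comp ht).const_mul _).congr' ?_
  filter_upwards [eventually_eventually_nhdsWithin.2 hF, self_mem_nhdsWithin,
    Ioo_mem_nhdsLT (by norm_num : (-1 : ℝ) < 1)] with r hr hr1 hrI
  -- Since r < 1, the one-sided identity holds on a full neighbourhood of r and can be
  -- differentiated there.
  rw [isOpen_Iio.nhdsWithin_eq hr1] at hr
  have he : deriv V =ᶠ[𝓝 r] fun r => F (1 - r) := by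
    filter_upwards [hr, isOpen_Ioo.mem_nhds hrI] with y hy hyI
    rw [(hV y hyI).deriv, hy]
  rw [iteratedDeriv_succ', he.iteratedDeriv_eq, iteratedDeriv_comp_const_sub]
  simp only [Function.comp, smul_eq_mul, mul_div_assoc]

theorem tendsto_iteratedDeriv_succ_right {V h F : ℝ → ℝ} {i : ℕ} {p l : ℝ}
    (hV : ∀ r ∈ Ioo (-1 : ℝ) 1, HasDerivAt V (h r) r) (hF : ∀ᶠ r in 𝓝[>] (-1), h r = F (1 + r))
    (hl : Tendsto (fun t : ℝ => iteratedDeriv i F t / t ^ p) (𝓝[>] 0) (𝓝 l)) :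
    Tendsto (fun r : ℝ => iteratedDeriv (i + 1) V r / (1 + r) ^ p) (𝓝[>] (-1)) (𝓝 l) := by
  have ht := tendsto_one_add_nhdsGT
  refine (hl.comp ht).congr' ?_
  filter_upwards [eventually_eventually_nhdsWithin.2 hF, self_mem_nhdsWithin,
    Ioo_mem_nhdsGT (by norm_num : (-1 : ℝ) < 1)] with r hr hr1 hrI
  rw [isOpen_Ioi.nhdsWithin_eq hr1] at hr
  have he : deriv V =ᶠ[𝓝 r] fun r => F (1 + r) := by
    filter_upwards [hr, isOpen_Ioo.mem_nhds hrI] with y hy hyI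
    rw [(hV y hyI).deriv, hy]
  rw [iteratedDeriv_succ', he.iteratedDeriv_eq, iteratedDeriv_comp_const_add]
  rfl

theorem intervalIntegrable_of_bounded_continuousOn_Ioo {h : ℝ → ℝ} {a b K : ℝ} (hab : a ≤ b)
    (hc : ContinuousOn h (Ioo a b)) (hK : ∀ r, |h r| ≤ K) : IntervalIntegrable h volume a b := by
  rw [intervalIntegrable_iff_integrableOn_Ioo_of_le hab]
  exact Integrable.of_bound (hc.aestronglyMeasurable measurableSet_Ioo) K (Eventually.of_forall hK)

theorem hasDerivAt_integral_of_continuousOn_Ioo {h : ℝ → ℝ} {a b r : ℝ}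
    (hc : ContinuousOn h (Ioo a b)) (hi : IntervalIntegrable h volume a b) (hr : r ∈ Ioo a b) :
    HasDerivAt (fun r => ∫ ρ in a..r, h ρ) (h r) r := by
  refine intervalIntegral.integral_hasDerivAt_right
    (hi.mono_set (uIcc_subset_uIcc left_mem_uIcc ?_))
    (hc.stronglyMeasurableAtFilter isOpen_Ioo r hr) (hc.continuousAt (isOpen_Ioo.mem_nhds hr))
  rw [uIcc_of_le (hr.1.trans hr.2).le]
  exact Ioo_subset_Icc_self hr

theorem mainTheorem3 (s α β κ C₁ C₂ : ℝ)
    (hs : s ∈ Ioo (0 : ℝ) 1) (hα : α ∈ Ioc (0 : ℝ) (2 * s)) (hβ : β ∈ Ioc (0 : ℝ) (2 * s))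
    (hκ : 0 < κ) (hC₁ : 0 < C₁) (hC₂ : 0 < C₂)
    (φ : ℝ → ℝ) (hφ : ContDiff ℝ ∞ φ) (hφ' : ∀ x, 0 < deriv φ x)
    (hleft : ∀ x, x < -κ → φ x = -1 + C₁ * |x| ^ (-α))
    (hright : ∀ x, κ < x → φ x = 1 - C₂ * |x| ^ (-β)) :
    -- the objects are well defined
    (∀ x, FracLapConverges s φ x) ∧
    IntervalIntegrable (layerForce s φ) volume (-1) 1 ∧
    ContDiffOn ℝ ∞ (layerPotential s φ) (Ioo (-1) 1) ∧
    -- the limits exist and are finite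
    ∀ i : ℕ,
      (∃ l : ℝ, Tendsto
        (fun r : ℝ => iteratedDeriv (i + 1) (layerPotential s φ) r / (1 + r) ^ (2 * s / α - (i : ℝ)))
        (𝓝[>] (-1)) (𝓝 l)) ∧
      (∃ l : ℝ, Tendsto
        (fun r : ℝ => iteratedDeriv (i + 1) (layerPotential s φ) r / (1 - r) ^ (2 * s / β - (i : ℝ)))
        (𝓝[<] 1) (𝓝 l)) := by
  have hu := powerTails_of_eq hφ hleft hright
  obtain ⟨A, hA⟩ := hu.exists_bound hα.1 hβ.1
  obtain ⟨B, hB⟩ := hu.exists_bound_deriv_deriv hα.1 hβ.1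
  have hinj : Function.Injective φ := (strictMono_of_deriv_pos hφ').injective
  have hforce : ∀ r, layerForce s φ r = symmFracLap s φ (Function.invFun φ r) := fun r => by
    rw [layerForce, fracLap_eq_symmFracLap hs hφ hA hB]
  have hforce' : ∀ x, layerForce s φ (φ x) = symmFracLap s φ x := fun x => by
    rw [hforce, Function.leftInverse_invFun hinj]
  have hsmooth : ContDiffOn ℝ ∞ (layerForce s φ) (Ioo (-1) 1) := by
    intro r hr
    obtain ⟨x, rfl⟩ := exists_eq_of_tails hα.1 hβ.1 hφ.continuous hleft hright hr
    rw [funext hforce]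
    exact ((hu.contDiff_symmFracLap hs hα.1 hβ.1).contDiffAt.comp _
      (contDiffAt_invFun hφ hφ' x)).contDiffWithinAt
  obtain ⟨K, hK⟩ := abs_symmFracLap_le hs hφ hA hB
  -- The bound holds for every real r, since off the range of φ `Function.invFun` still returns some
  -- real number.
  have hint : IntervalIntegrable (layerForce s φ) volume (-1) 1 :=
    intervalIntegrable_of_bounded_continuousOn_Ioo (by norm_num) hsmooth.continuousOn
      fun r => (hforce r).symm ▸ hK _
  have hV : ∀ r ∈ Ioo (-1 : ℝ) 1, HasDerivAt (layerPotential s φ) (layerForce s φ r) r :=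
    fun r hr => hasDerivAt_integral_of_continuousOn_Ioo hsmooth.continuousOn hint hr
  refine ⟨fracLapConverges_of_bounded hs hφ hA hB, hint, ?_, fun i => ⟨?_, ?_⟩⟩
  · rw [contDiffOn_infty_iff_deriv_of_isOpen isOpen_Ioo]
    exact ⟨fun r hr => (hV r hr).differentiableAt.differentiableWithinAt,
      hsmooth.congr fun r hr => (hV r hr).deriv⟩
  -- The reflected profile φ(-x) has exponent α at +∞, so the roles of α and β are exchanged.
  · obtain ⟨l, hl⟩ := hu.reflect.tendsto_iteratedDeriv_symmFracLap hs hβ.1 hα.1 hC₁ i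
    refine ⟨l, tendsto_iteratedDeriv_succ_right hV ?_ hl⟩
    have ht := tendsto_one_add_nhdsGT
    filter_upwards [ht self_mem_nhdsWithin, ht.eventually
      ((tendsto_div_rpow_neg_inv hα.1 hC₁).eventually_gt_atTop κ)] with r hr hrκ
    rw [← symmFracLap_neg, ← hforce', hleft _ (by linarith), abs_neg,
      abs_of_pos (hκ.trans hrκ), mul_rpow_neg_inv_rpow hα.1 hC₁ hr]
    congr 1; ring
  · obtain ⟨l, hl⟩ := hu.tendsto_iteratedDeriv_symmFracLap hs hα.1 hβ.1 hC₂ i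
    refine ⟨_, tendsto_iteratedDeriv_succ_left hV ?_ hl⟩
    have ht := tendsto_one_sub_nhdsLT
    filter_upwards [ht self_mem_nhdsWithin, ht.eventually
      ((tendsto_div_rpow_neg_inv hβ.1 hC₂).eventually_gt_atTop κ)] with r hr hrκ
    rw [← hforce', hright _ hrκ, abs_of_pos (hκ.trans hrκ), mul_rpow_neg_inv_rpow hβ.1 hC₂ hr]
    congr 1; ring
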